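/- Let $\Phi$ be a finite (reduced, crystallographic) root system in a finite-dimensional real vector space, with a chosen base $\Delta$ of simple roots, positive roots $\Phi^+$, and Weyl group $W$; for $\alpha\in\Phi$ let $s_\alpha\in W$ be the corresponding reflection. Let $\ell(w)$ be the least number of simple reflections whose product is $w$. The (strong) Bruhat order on $W$ is the partial order generated by the relations $w<ws_\alpha$ for $\alpha\in\Phi^+$ with $\ell(w)<\ell(ws_\alpha)$; write $\lessdot$ for its cover relation and $[u,v]=\{w\in W: u\le w\le v\}$. The Bruhat graph has vertex set $W$ and an edge joining $w$ and $s_\alpha w$, with label $\mathrm{wt}(w,s_\alpha w)=\alpha$, for each $w\in W$ and $\alpha\in\Phi^+$. For $u\le v$ let \[\mathrm{AD}(u,v)=\mathrm{span}_{\mathbb R}\{\mathrm{wt}(x,y)\;:\; u\le x<y\le v,\ x \text{ and } y \text{ joined by an edge of the Bruhat graph}\}.\] Then: 1. For any $u\le w\lessdot v$ in $W$, $\mathrm{AD}(u,v)=\mathrm{AD}(u,w)+\mathbb R\cdot \mathrm{wt}(w,v)$. 2. For any saturated chain $u=w^{(0)}\lessdot w^{(1)}\lessdot\cdots\lessdot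 w^{(n)}=v$ (with $n\ge 0$), $\mathrm{AD}(u,v)=\mathrm{span}_{\mathbb R}\{\mathrm{wt}(w^{(i)},w^{(i+1)}) : 0\le i\le n-1\}$. 3. For any $u\le v$ and any $w\in[u,v]$, $\mathrm{AD}(u,v)$ is the real span of the labels of all cover relations incident to $w$ inside $[u,v]$, that is, of all $\mathrm{wt}(x,y)$ with $u\le x\lessdot y\le v$ and $w\in\{x,y\}$. -/

import Mathlib

namespace RootPairing.Base

section

variable {ι M N : Type*} [AddCommGroup M] [Module ℝ M] [AddCommGroup N] [Module ℝ N]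
  {P : RootPairing ι ℝ M N} (b : P.Base)

/-- The Coxeter length of `w`: the smallest `n` such that `w` is a product of `n` simple
reflections. -/
noncomputable def coxeterLength (w : P.weylGroup) : ℕ :=
  sInf {n | ∃ l : List ι, (∀ i ∈ l, i ∈ b.support) ∧ l.length = n ∧
    (l.map (weylGroup.ofIdx P)).prod = w}

/-- The generating relations `w < w s_α` of the Bruhat order, where `α` is a positive root and
`ℓ(w) < ℓ(w s_α)`. -/
def BruhatStep (w w' : P.weylGroup) : Prop :=
  ∃ i : ι, b.IsPos i ∧ w' = w * weylGroup.ofIdx P i ∧ b.coxeterLength w < b.coxeterLength w'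

theorem coxeterLength_le_of_reflTransGen {u v : P.weylGroup}
    (h : Relation.ReflTransGen b.BruhatStep u v) :
    u = v ∨ b.coxeterLength u < b.coxeterLength v := by
  induction h with
  | refl => exact Or.inl rfl
  | tail _ hs ih =>
    obtain ⟨_, _, _, hlt⟩ := hs
    rcases ih with rfl | ih
    · exact Or.inr hlt
    · exact Or.inr (ih.trans hlt)

/-- The (strong) Bruhat order on the Weyl group, with respect to the base `b`. -/
@[reducible]
def bruhatOrder : PartialOrder P.weylGroup where
  le := Relation.ReflTransGen b.BruhatStep
  le_refl _ := Relation.ReflTransGen.refl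
  le_trans _ _ _ := Relation.ReflTransGen.trans
  le_antisymm u v huv hvu := by
    rcases b.coxeterLength_le_of_reflTransGen huv with h | h
    · exact h
    · rcases b.coxeterLength_le_of_reflTransGen hvu with h' | h'
      · exact h'.symm
      · exact absurd h' h.asymm

/-- `u ≤ v` in the Bruhat order. -/
def BruhatLE (u v : P.weylGroup) : Prop := (bruhatOrder b).le u v

/-- `u < v` in the Bruhat order. -/
def BruhatLT (u v : P.weylGroup) : Prop := (bruhatOrder b).lt u v

/-- `u ⋖ v` in the Bruhat order. -/
def BruhatCovBy (u v : P.weylGroup) : Prop :=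
  @CovBy P.weylGroup (bruhatOrder b).toLT u v

theorem ofIdx_mul_self (i : ι) : weylGroup.ofIdx P i * weylGroup.ofIdx P i = 1 := by
  rw [mul_eq_one_iff_inv_eq]
  exact Subtype.ext (Equiv.reflection_inv P i)

theorem ofIdx_ne_one (i : ι) : weylGroup.ofIdx P i ≠ 1 := by
  intro h
  have h1 : weylGroup.ofIdx P i • P.root i = (1 : P.weylGroup) • P.root i := by rw [h]
  rw [weylGroup.ofIdx_smul, Equiv.reflection_smul, one_smul, P.reflection_apply_self] at h1
  have h2 : (2 : ℝ) • P.root i = 0 := by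
    rw [two_smul]
    nth_rewrite 1 [← h1]
    exact neg_add_cancel _
  exact P.ne_zero i ((smul_eq_zero.mp h2).resolve_left two_ne_zero)

/-- The (undirected) Bruhat graph: its vertices are the elements of the Weyl group, and its edges
join `w` to `s_α w`, for `α` a positive root. -/
def bruhatGraph : SimpleGraph P.weylGroup where
  Adj x y := ∃ i : ι, b.IsPos i ∧ y = weylGroup.ofIdx P i * x
  symm := by
    constructor
    rintro x y ⟨i, hi, rfl⟩
    exact ⟨i, hi, by rw [← mul_assoc, ofIdx_mul_self, one_mul]⟩
  loopless := by
    constructor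
    rintro x ⟨i, -, h⟩
    exact ofIdx_ne_one i (mul_eq_right.mp h.symm)

open Classical in
/-- The label (or weight) of the edge of the Bruhat graph joining `x` and `y`: the positive root `α`
with `y = s_α x`. By convention it is `0` if `x` and `y` are not adjacent. -/
noncomputable def wt (x y : P.weylGroup) : M :=
  if h : (b.bruhatGraph).Adj x y then P.root h.choose else 0

/-- The label of an edge is well defined. -/
theorem wt_ofIdx_mul [P.IsReduced] {i : ι} (hi : b.IsPos i) (x : P.weylGroup) :
    b.wt x (weylGroup.ofIdx P i * x) = P.root i := by
  have hadj : (b.bruhatGraph).Adj x (weylGroup.ofIdx P i * x) := ⟨i, hi, rfl⟩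
  rw [wt, dif_pos hadj]
  obtain ⟨hj, h⟩ := hadj.choose_spec
  generalize hadj.choose = j at hj h ⊢
  have h1 : weylGroup.ofIdx P i • P.root i = weylGroup.ofIdx P j • P.root i := by
    rw [mul_right_cancel h]
  rw [weylGroup.ofIdx_smul, weylGroup.ofIdx_smul, Equiv.reflection_smul, Equiv.reflection_smul,
    P.reflection_apply_self, P.reflection_apply_root] at h1
  have h2 : ¬ LinearIndependent ℝ ![P.root j, P.root i] := by
    intro hli
    have := LinearIndependent.pair_iff.mp hli (-P.pairing i j) 2 (by
      rw [two_smul, neg_smul]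
      nth_rewrite 1 [← neg_neg (P.root i)]
      rw [h1]
      abel)
    exact two_ne_zero this.2
  rcases IsReduced.eq_or_eq_neg j i h2 with h3 | h3
  · exact h3
  · exfalso
    let := P.indexNeg
    have h4 : j = -i := P.root.injective (by simpa using h3)
    rw [h4] at hj
    exact (IsPos.neg_iff_not b i).mp hj hi

/-- The real span `AD(u, v)` of the labels of all edges of the Bruhat graph restricted to the Bruhat
interval `[u, v]`. -/
def AD (u v : P.weylGroup) : Submodule ℝ M :=
  Submodule.span ℝ {a | ∃ x y, (b.bruhatGraph).Adj x y ∧ b.BruhatLE u x ∧ b.BruhatLT x y ∧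
    b.BruhatLE y v ∧ a = b.wt x y}

end

end RootPairing.Base

/-!
Fix a subspace `L` of `M` and identify elements of the Weyl group that act in the same way modulo
`L`. Since a reflection acts as the identity modulo `L` exactly when its root lies in `L`, all
labels of `[u, v]` lie in `L` if and only if all of `[u, v]` is identified with `u`
(`RootPairing.Base.AD_le_iff`). The identification is compatible with right multiplication, and this
is all that is needed about it. The claim for `u ≤ w ⋖ v` becomes: if `[u, w]` is a single class and
`w`, `v` are identified, then `[u, v]` is a single class.

This is proved in any group with an order that has the lifting property of the Bruhat order
(`IsLiftingOrder`), by induction on the length of `v`. Choose a simple reflection `s` with `vs < v`.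
If `us < u`, then `s` may be removed from both ends of `[u, v]`
(`IsLiftingOrder.constOnInterval_mul_iff`). If `u < us`, then every element of `[u, v]` is `x` or
`xs` for some `x` in `[u, vs]`, and it suffices to treat `[u, vs]` and to identify `vs` with `v`
(`IsLiftingOrder.constOnInterval_of_ascent`). Comparing `w` with `ws` then leaves four cases. The
mirror statement for `u ⋖ w ≤ v` (`IsLiftingOrder.constOnInterval_of_covBy_le`) comes first, since
it enters the other one.

The claim on saturated chains follows by induction. For the labels at `w`, it suffices to show that
the labels of the atoms, and those of the coatoms, span all labels of an interval. By induction this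
reduces to an interval of length two, whose labels lie in a plane: it has a second atom and a second
coatom (`IsLiftingOrder.exists_ne_between`), and the labels of two atoms, or of two coatoms, are
linearly independent because the root system is reduced.

The lifting property of the Weyl group (`RootPairing.Base.isLiftingOrder_bruhatOrder`) rests on the
strong exchange condition, which holds because a simple reflection permutes the positive roots other
than its own (`RootPairing.Base.exists_shorter_word`).
-/

/-! ### Orders with the lifting property -/

/-- A partial order on a group `W` that behaves under right multiplication by the elements of `S`
as the Bruhat order of a Coxeter group with length function `ℓ` and simple reflections `S`. The
fields `lift_right` and `lift_left` together are the lifting property. -/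
structure IsLiftingOrder {W : Type*} [Group W] [PartialOrder W] (S : Set W) (ℓ : W → ℕ) :
    Prop where
  mul_self : ∀ s ∈ S, s * s = 1
  strictMono : StrictMono ℓ
  length_mul_le : ∀ s ∈ S, ∀ w, ℓ (w * s) ≤ ℓ w + 1
  lt_or_gt : ∀ s ∈ S, ∀ w, w < w * s ∨ w * s < w
  lift_right : ∀ s ∈ S, ∀ x y, x ≤ y → x * s ≤ y ∨ x * s ≤ y * s
  lift_left : ∀ s ∈ S, ∀ x y, x ≤ y → x ≤ y * s ∨ x * s ≤ y * s
  exists_descent : ∀ u v, u < v → ∃ s ∈ S, v * s < v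

/-- The function `f` is constant on the interval `[u, v]`. -/
def ConstOnInterval {W X : Type*} [Preorder W] (f : W → X) (u v : W) : Prop :=
  ∀ x, u ≤ x → x ≤ v → f x = f u

namespace IsLiftingOrder

variable {W X : Type*} [Group W] [PartialOrder W] {S : Set W} {ℓ : W → ℕ}

section

variable (h : IsLiftingOrder S ℓ) {s : W} (hs : s ∈ S) {u v w x y : W}

include h

theorem exists_covBy_le (huv : u < v) : ∃ a, u ⋖ a ∧ a ≤ v := by
  have hne : {x | u < x ∧ x ≤ v}.Nonempty := ⟨v, huv, le_rfl⟩
  obtain ⟨a, ⟨hua, hav⟩, hmin⟩ :=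
    WellFounded.has_min (InvImage.wf ℓ Nat.lt_wfRel.wf) _ hne
  exact ⟨a, ⟨hua, fun c huc hca ↦ hmin c ⟨huc, hca.le.trans hav⟩ (h.strictMono hca)⟩, hav⟩

theorem exists_le_covBy (huv : u < v) : ∃ a, u ≤ a ∧ a ⋖ v := by
  have hne : {x | u ≤ x ∧ x < v}.Nonempty := ⟨u, le_rfl, huv⟩
  obtain ⟨a, ⟨hua, hav⟩, hmin⟩ :=
    WellFounded.has_min (InvImage.wf (fun x ↦ ℓ v - ℓ x) Nat.lt_wfRel.wf) _ hne
  refine ⟨a, hua, hav, fun c hac hcv ↦ hmin c ⟨hua.trans hac.le, hcv⟩ ?_⟩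
  have h1 := h.strictMono hac
  have h2 := h.strictMono hcv
  change ℓ v - ℓ c < ℓ v - ℓ a
  omega

include hs

theorem mul_mul_self (x : W) : x * s * s = x := by
  rw [mul_assoc, h.mul_self s hs, mul_one]

theorem mul_le_of_descent (hxy : x ≤ y) (hy : y * s < y) : x * s ≤ y :=
  (h.lift_right s hs x y hxy).elim id fun h' ↦ h'.trans hy.le

theorem le_mul_of_ascent (hxy : x ≤ y) (hx : x < x * s) : x ≤ y * s :=
  (h.lift_left s hs x y hxy).elim id hx.le.trans

theorem mul_le_mul_of_descent (hxy : x ≤ y) (hx : x * s < x) :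
    x * s ≤ y * s :=
  h.le_mul_of_ascent hs (hx.le.trans hxy) (by rw [h.mul_mul_self hs]; exact hx)

theorem mul_le_mul_of_ascent (hxy : x ≤ y) (hy : y < y * s) :
    x * s ≤ y * s := by
  refine h.mul_le_of_descent hs (hxy.trans hy.le) ?_
  rw [h.mul_mul_self hs]
  exact hy

theorem covBy_mul (hx : x < x * s) : x ⋖ x * s := by
  refine ⟨hx, fun z h1 h2 ↦ ?_⟩
  have h3 := h.strictMono h1
  have h4 := h.strictMono h2
  have h5 := h.length_mul_le s hs x
  omega

theorem mul_covBy (hx : x * s < x) : x * s ⋖ x := by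
  have := h.covBy_mul hs (x := x * s) (by rwa [h.mul_mul_self hs])
  rwa [h.mul_mul_self hs] at this

/-- A cover leads from an ascent to a descent of `s` only by multiplication by `s`. -/
theorem eq_mul_of_covBy (hwv : w ⋖ v) (hw : w < w * s) (hv : v * s < v) : w = v * s :=
  by_contra fun hne ↦ hwv.2 ((h.le_mul_of_ascent hs hwv.le hw).lt_of_ne hne) hv

theorem mul_covBy_mul (hwv : w ⋖ v) (hw : w * s < w) (hv : v * s < v) : w * s ⋖ v * s := by
  refine ⟨(h.mul_le_mul_of_descent hs hwv.le hw).lt_of_ne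
    fun e ↦ hwv.lt.ne (mul_right_cancel e), fun z hwz hzv ↦ ?_⟩
  have hws : w * s < w * s * s := by rwa [h.mul_mul_self hs]
  rcases h.lt_or_gt s hs z with hz | hz
  · have h1 := h.mul_le_mul_of_ascent hs hwz.le hz
    rw [h.mul_mul_self hs] at h1
    have h2 := h.mul_le_of_descent hs (hzv.le.trans hv.le) hv
    refine hwv.2 (h1.lt_of_ne fun e ↦ hwz.ne ?_) (h2.lt_of_ne fun e ↦ hzv.ne ?_)
    · rw [e, h.mul_mul_self hs]
    · rw [← e, h.mul_mul_self hs]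
  · have h1 := h.mul_le_of_descent hs hwz.le hz
    rw [h.mul_mul_self hs] at h1
    exact hwv.2 (h1.trans_lt hzv) hv

end

/-! ### Functions that are constant on intervals -/

section

variable (h : IsLiftingOrder S ℓ) {f : W → X}
  (hf : ∀ s ∈ S, ∀ x y, f x = f y → f (x * s) = f (y * s)) {s : W} (hs : s ∈ S) {u v w : W}

include h hf

section

include hs

/-- If `s` is an ascent of `u`, then constancy on `[u, vs]` and on `{vs, v}` implies constancy on
`[u, v]`, because one of `x`, `xs` lies in `[u, vs]` whenever `x` lies in `[u, v]`. -/
theorem constOnInterval_of_ascent (hu : u < u * s) (huv : u ≤ v)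
    (hc : ConstOnInterval f u (v * s)) (hvs : f (v * s) = f v) : ConstOnInterval f u v := by
  have h1 := hc _ (h.le_mul_of_ascent hs huv hu) le_rfl
  have h2 := hf s hs _ _ h1
  rw [h.mul_mul_self hs] at h2
  intro x hux hxv
  rcases h.lt_or_gt s hs x with hx | hx
  · exact hc x hux (h.le_mul_of_ascent hs hxv hx)
  · have h3 := hf s hs _ _ <| hc (x * s) (h.le_mul_of_ascent hs hux hu)
      (h.mul_le_mul_of_descent hs hxv hx)
    rw [h.mul_mul_self hs] at h3
    rw [h3, ← h2, ← hvs, h1]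

/-- A common descent of both ends may be removed. The intervals `[u, v]` and `[us, vs]` need not be
translates of each other, but `f` is constant on both or on neither. -/
theorem constOnInterval_mul_iff (hu : u * s < u) (hv : v * s < v) (huv : u ≤ v) :
    ConstOnInterval f (u * s) (v * s) ↔ ConstOnInterval f u v := by
  have hu' : u * s < u * s * s := by rwa [h.mul_mul_self hs]
  constructor
  · intro hc x hux hxv
    rcases h.lt_or_gt s hs x with hx | hx
    · have hxvs := h.le_mul_of_ascent hs hxv hx
      rw [hc x (hu.le.trans hux) hxvs, hc u hu.le (hux.trans hxvs)]
    · have h1 := hf s hs _ _ <| hc (x * s)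
        (h.le_mul_of_ascent hs (hu.le.trans hux) hu') (h.mul_le_mul_of_descent hs hxv hx)
      rwa [h.mul_mul_self hs, h.mul_mul_self hs] at h1
  · intro hc x hux hxv
    rcases h.lt_or_gt s hs x with hx | hx
    · have h1 := h.mul_le_mul_of_ascent hs hux hx
      rw [h.mul_mul_self hs] at h1
      have h2 := hf s hs _ _ <| hc _ h1 (h.mul_le_of_descent hs (hxv.trans hv.le) hv)
      rwa [h.mul_mul_self hs] at h2
    · have h1 := h.mul_le_of_descent hs hux hx
      rw [h.mul_mul_self hs] at h1
      have h2 := hf s hs _ _ (hc _ (h1.trans hxv) hv.le)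
      rw [h.mul_mul_self hs] at h2
      rw [hc x h1 (hxv.trans hv.le), ← h2, hc v huv le_rfl]

end

/-- Constancy on `[w, v]` and on the two-element interval `[u, w]` implies constancy on
`[u, v]`. -/
theorem constOnInterval_of_covBy_le (huw : u ⋖ w) (hwv : w ≤ v) (hfuw : f u = f w)
    (hc : ConstOnInterval f w v) : ConstOnInterval f u v := by
  induction hn : ℓ v using Nat.strong_induction_on generalizing u w v with
  | _ n ih =>
  subst hn
  have huv := huw.lt.trans_le hwv
  obtain ⟨s, hs, hv⟩ := h.exists_descent u v huv
  have hlt := h.strictMono hv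
  rcases h.lt_or_gt s hs u with hu | hu <;> rcases h.lt_or_gt s hs w with hw | hw
  · have hwvs := h.le_mul_of_ascent hs hwv hw
    exact h.constOnInterval_of_ascent hf hs hu huv.le
      (ih _ hlt huw hwvs hfuw (fun x h1 h2 ↦ hc x h1 (h2.trans hv.le)) rfl)
      ((hc _ hwvs hv.le).trans (hc _ hwv le_rfl).symm)
  · have e := h.eq_mul_of_covBy hs huw hu hw
    have hc' := (h.constOnInterval_mul_iff hf hs hw hv hwv).2 hc
    rw [← e] at hc'
    have h1 := hc _ hwv le_rfl
    have h2 := hf s hs _ _ h1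
    rw [← e] at h2
    exact h.constOnInterval_of_ascent hf hs hu huv.le hc' (by rw [h2, hfuw, h1])
  · -- Here `u * s ⋖ u ⋖ w`, so `[u * s, v * s]` is reached from `[w, v * s]` by way of
    -- `[u, v * s]`.
    rw [← h.constOnInterval_mul_iff hf hs hu hv huv.le]
    have hwvs := h.le_mul_of_ascent hs hwv hw
    refine ih _ hlt (h.mul_covBy hs hu) (huw.le.trans hwvs) ?_
      (ih _ hlt huw hwvs hfuw (fun x h1 h2 ↦ hc x h1 (h2.trans hv.le)) rfl) rfl
    rw [hf s hs _ _ hfuw, hfuw]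
    exact hc _ hw.le (h.mul_le_of_descent hs hwv hv)
  · rw [← h.constOnInterval_mul_iff hf hs hu hv huv.le]
    exact ih _ hlt (h.mul_covBy_mul hs huw hu hw) (h.mul_le_mul_of_descent hs hwv hw)
      (hf s hs _ _ hfuw) ((h.constOnInterval_mul_iff hf hs hw hv hwv).2 hc) rfl

/-- Constancy on `[u, w]` and on the two-element interval `[w, v]` implies constancy on
`[u, v]`. -/
theorem constOnInterval_of_le_covBy (huw : u ≤ w) (hwv : w ⋖ v) (hfwv : f w = f v)
    (hc : ConstOnInterval f u w) : ConstOnInterval f u v := by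
  induction hn : ℓ v using Nat.strong_induction_on generalizing u w v with
  | _ n ih =>
  subst hn
  have huv := huw.trans_lt hwv.lt
  obtain ⟨s, hs, hv⟩ := h.exists_descent u v huv
  have hlt := h.strictMono hv
  rcases h.lt_or_gt s hs w with hw | hw
  · have e := h.eq_mul_of_covBy hs hwv hw hv
    rcases h.lt_or_gt s hs u with hu | hu
    · exact h.constOnInterval_of_ascent hf hs hu huv.le (e ▸ hc) (e ▸ hfwv)
    · -- Now `v * s = w`, and `[u, w]` has to be extended downwards to `[u * s, w]`.
      rw [← h.constOnInterval_mul_iff hf hs hu hv huv.le, ← e]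
      have h1 := hc w huw le_rfl
      have h2 := hf s hs _ _ h1
      rw [e, h.mul_mul_self hs] at h2
      exact h.constOnInterval_of_covBy_le hf (h.mul_covBy hs hu) huw
        (by rw [← h2, ← hfwv, h1]) hc
  · have hcov := h.mul_covBy_mul hs hwv hw hv
    rcases h.lt_or_gt s hs u with hu | hu
    · have huws := h.le_mul_of_ascent hs huw hu
      refine h.constOnInterval_of_ascent hf hs hu huv.le
        (ih _ hlt huws hcov (hf s hs _ _ hfwv) (fun x h1 h2 ↦ hc x h1 (h2.trans hw.le)) rfl) ?_
      rw [← hf s hs _ _ hfwv, hc _ huws hw.le, ← hfwv, hc _ huw le_rfl]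
    · rw [← h.constOnInterval_mul_iff hf hs hu hv huv.le]
      exact ih _ hlt (h.mul_le_mul_of_descent hs huw hu) hcov (hf s hs _ _ hfwv)
        ((h.constOnInterval_mul_iff hf hs hu hw huw).2 hc) rfl

end

/-! ### Intervals of length two -/

section

variable (h : IsLiftingOrder S ℓ) {u a b : W}

include h

theorem exists_ne_between (hua : u ⋖ a) (hab : a ⋖ b) : ∃ c, c ≠ a ∧ u < c ∧ c < b := by
  induction hn : ℓ b using Nat.strong_induction_on generalizing u a b with
  | _ n ih =>
  subst hn
  have hub := hua.lt.trans hab.lt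
  obtain ⟨s, hs, hb⟩ := h.exists_descent u b hub
  have hlt := h.strictMono hb
  rcases h.lt_or_gt s hs u with hu | hu
  · rcases h.lt_or_gt s hs a with ha | ha
    · have e := h.eq_mul_of_covBy hs hab ha hb
      refine ⟨u * s, fun e' ↦ ?_, hu, (h.mul_le_of_descent hs hub.le hb).lt_of_ne fun e' ↦ ?_⟩
      · rw [← e', h.mul_mul_self hs] at ha
        exact ha.not_gt hu
      · rw [e, ← e', h.mul_mul_self hs] at hua
        exact hua.lt.false
    · have e := h.eq_mul_of_covBy hs hua hu ha
      refine ⟨b * s, fun e' ↦ ?_, (h.le_mul_of_ascent hs hub.le hu).lt_of_ne fun e' ↦ ?_, hb⟩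
      · rw [← e', h.mul_mul_self hs] at ha
        exact ha.not_gt hb
      · exact hab.lt.ne (mul_right_cancel (e.symm.trans e'))
  · have hu' : u * s < u * s * s := by rwa [h.mul_mul_self hs]
    rcases h.lt_or_gt s hs a with ha | ha
    · -- Here `u * s ⋖ u ⋖ a`, and a second element between `u * s` and `a` is moved up by `s`.
      have e := h.eq_mul_of_covBy hs hab ha hb
      obtain ⟨c, hcu, h1, h2⟩ := ih _ (h.strictMono hab.lt) (h.mul_covBy hs hu) hua rfl
      have hc : c < c * s := by
        refine (h.lt_or_gt s hs c).resolve_right fun hc ↦ ?_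
        have h3 := h.mul_le_of_descent hs h1.le hc
        rw [h.mul_mul_self hs] at h3
        exact hua.2 (h3.lt_of_ne hcu.symm) h2
      refine ⟨c * s, fun e' ↦ ?_, ?_, ?_⟩
      · rw [← e', h.mul_mul_self hs] at ha
        exact ha.not_gt hc
      · have h3 := h.mul_le_mul_of_ascent hs h1.le hc
        rw [h.mul_mul_self hs] at h3
        refine h3.lt_of_ne fun e' ↦ h1.ne ?_
        rw [e', h.mul_mul_self hs]
      · refine (h.mul_le_of_descent hs (h2.le.trans hab.le) hb).lt_of_ne fun e' ↦ h2.ne ?_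
        rw [e, ← e', h.mul_mul_self hs]
    · obtain ⟨c, hca, h1, h2⟩ := ih _ hlt (h.mul_covBy_mul hs hua hu ha)
        (h.mul_covBy_mul hs hab ha hb) rfl
      rcases h.lt_or_gt s hs c with hc | hc
      · have h3 := h.mul_le_mul_of_ascent hs h1.le hc
        rw [h.mul_mul_self hs] at h3
        refine ⟨c * s, fun e' ↦ hca ?_, h3.lt_of_ne fun e' ↦ h1.ne ?_,
          (h.mul_le_of_descent hs (h2.le.trans hb.le) hb).lt_of_ne fun e' ↦ h2.ne ?_⟩
        · rw [← e', h.mul_mul_self hs]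
        · rw [e', h.mul_mul_self hs]
        · rw [← e', h.mul_mul_self hs]
      · have h3 := h.mul_le_of_descent hs h1.le hc
        rw [h.mul_mul_self hs] at h3
        refine ⟨b * s, fun e' ↦ ?_, h3.trans_lt h2, hb⟩
        rw [← e', h.mul_mul_self hs] at ha
        exact ha.not_gt hb

theorem exists_ne_atom (hua : u ⋖ a) (hab : a ⋖ b) : ∃ c, c ≠ a ∧ u ⋖ c ∧ c ≤ b := by
  obtain ⟨d, hda, hud, hdb⟩ := h.exists_ne_between hua hab
  obtain ⟨c, huc, hcd⟩ := h.exists_covBy_le hud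
  refine ⟨c, ?_, huc, hcd.trans hdb.le⟩
  rintro rfl
  exact hab.2 (hcd.lt_of_ne hda.symm) hdb

theorem exists_ne_coatom (hua : u ⋖ a) (hab : a ⋖ b) : ∃ c, c ≠ a ∧ u ≤ c ∧ c ⋖ b := by
  obtain ⟨d, hda, hud, hdb⟩ := h.exists_ne_between hua hab
  obtain ⟨c, hdc, hcb⟩ := h.exists_le_covBy hdb
  refine ⟨c, ?_, hud.le.trans hdc, hcb⟩
  rintro rfl
  exact hua.2 hud (hdc.lt_of_ne hda)

end

end IsLiftingOrder

/-! ### The lifting property for the Weyl group -/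

namespace RootPairing.Base

variable {ι M N : Type*} [AddCommGroup M] [Module ℝ M] [AddCommGroup N] [Module ℝ N]
  {P : RootPairing ι ℝ M N}

theorem weylGroup_ext {g g' : P.weylGroup} (h : ∀ m : M, g • m = g' • m) : g = g' :=
  Subtype.ext <| Equiv.weightHom_injective P <| LinearEquiv.ext h

theorem weylGroupToPerm_ofIdx (i j : ι) :
    P.weylGroupToPerm (weylGroup.ofIdx P i) j = P.reflectionPerm i j :=
  rfl

theorem weylGroup_smul_ofIdx_smul (g : P.weylGroup) (i : ι) (m : M) :
    g • weylGroup.ofIdx P i • m =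
      g • m - P.toLinearMap m (P.coroot i) • P.root (P.weylGroupToPerm g i) := by
  rw [weylGroup.ofIdx_smul, Equiv.reflection_smul, P.reflection_apply, smul_sub,
    ← weylGroup_apply_root]
  congr 1
  exact (Equiv.weightHom P g.1).map_smul _ _

theorem toLinearMap_weylGroup_smul (g : P.weylGroup) (i : ι) (m : M) :
    P.toLinearMap (g • m) (P.coroot (P.weylGroupToPerm g i)) = P.toLinearMap m (P.coroot i) := by
  have h1 := LinearMap.congr_fun
    (Hom.weight_coweight_transpose_apply P P (P.coroot (P.weylGroupToPerm g i)) g.1.toHom) m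
  rw [Hom.coroot_coweightMap_apply] at h1
  have h2 : (g.1.toHom.indexEquiv).symm (P.weylGroupToPerm g i) = i :=
    g.1.toHom.indexEquiv.symm_apply_apply i
  rw [h2] at h1
  exact h1

theorem weylGroup_mul_ofIdx (g : P.weylGroup) (i : ι) :
    g * weylGroup.ofIdx P i = weylGroup.ofIdx P (P.weylGroupToPerm g i) * g := by
  refine weylGroup_ext fun m ↦ ?_
  rw [mul_smul, mul_smul, weylGroup_smul_ofIdx_smul, ← one_smul P.weylGroup
    (weylGroup.ofIdx P (P.weylGroupToPerm g i) • g • m), weylGroup_smul_ofIdx_smul,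
    toLinearMap_weylGroup_smul]
  simp

theorem ofIdx_reflectionPerm (i j : ι) :
    weylGroup.ofIdx P (P.reflectionPerm j i) =
      weylGroup.ofIdx P j * weylGroup.ofIdx P i * weylGroup.ofIdx P j := by
  rw [weylGroup_mul_ofIdx (weylGroup.ofIdx P j) i, mul_assoc, ofIdx_mul_self, mul_one,
    weylGroupToPerm_ofIdx]

theorem ofIdx_reflectionPerm_self (i : ι) :
    weylGroup.ofIdx P (P.reflectionPerm i i) = weylGroup.ofIdx P i := by
  rw [ofIdx_reflectionPerm, ofIdx_mul_self, one_mul]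

variable {b : P.Base}

theorem BruhatStep.lt {x y : P.weylGroup} (h : b.BruhatStep x y) : b.BruhatLT x y :=
  let _ := b.bruhatOrder
  lt_of_le_of_ne (Relation.ReflTransGen.single h) fun e ↦ by
    obtain ⟨-, -, -, hlt⟩ := h
    exact (e ▸ hlt).false

variable (b)

theorem isPos_reflectionPerm_self_iff (i : ι) : b.IsPos (P.reflectionPerm i i) ↔ ¬ b.IsPos i :=
  IsPos.neg_iff_not b i

theorem coxeterLength_le_length {l : List ι} (hl : ∀ i ∈ l, i ∈ b.support) :
    b.coxeterLength (l.map (weylGroup.ofIdx P)).prod ≤ l.length :=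
  Nat.sInf_le ⟨l, hl, rfl, rfl⟩

variable [Finite ι] [P.IsCrystallographic] [P.IsReduced]

theorem ofIdx_mem_closure (i : ι) :
    weylGroup.ofIdx P i ∈ Submonoid.closure (weylGroup.ofIdx P '' b.support) := by
  refine b.induction_reflect i (fun i hi ↦ ?_)
    (fun i hi ↦ Submonoid.subset_closure (Set.mem_image_of_mem _ hi)) fun i j hi hj ↦ ?_
  · rwa [ofIdx_reflectionPerm_self]
  · have hj' := Submonoid.subset_closure (Set.mem_image_of_mem (weylGroup.ofIdx P) hj)
    rw [ofIdx_reflectionPerm]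
    exact mul_mem (mul_mem hj' hi) hj'

theorem mem_closure_simpleReflections (w : P.weylGroup) :
    w ∈ Submonoid.closure (weylGroup.ofIdx P '' b.support) := by
  obtain ⟨w, hw⟩ := w
  induction hw using weylGroup.induction with
  | mem i => exact b.ofIdx_mem_closure i
  | one => exact one_mem _
  | mul x y hx hy ihx ihy => exact mul_mem ihx ihy

theorem exists_reduced_word (w : P.weylGroup) :
    ∃ l : List ι, (∀ i ∈ l, i ∈ b.support) ∧ l.length = b.coxeterLength w ∧
      (l.map (weylGroup.ofIdx P)).prod = w := by
  refine Nat.sInf_mem (s := {n | ∃ l : List ι, (∀ i ∈ l, i ∈ b.support) ∧ l.length = n ∧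
    (l.map (weylGroup.ofIdx P)).prod = w}) ?_
  suffices ∃ l : List ι, (∀ i ∈ l, i ∈ b.support) ∧ (l.map (weylGroup.ofIdx P)).prod = w by
    obtain ⟨l, h1, h2⟩ := this
    exact ⟨_, l, h1, rfl, h2⟩
  induction b.mem_closure_simpleReflections w using Submonoid.closure_induction with
  | mem x hx =>
    obtain ⟨i, hi, rfl⟩ := hx
    exact ⟨[i], by simpa using hi, by simp⟩
  | one => exact ⟨[], by simp, rfl⟩
  | mul x y _ _ ihx ihy =>
    obtain ⟨l, h1, rfl⟩ := ihx
    obtain ⟨l', h1', rfl⟩ := ihy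
    refine ⟨l ++ l', fun i hi ↦ ?_, by simp⟩
    rcases List.mem_append.1 hi with hi | hi
    exacts [h1 i hi, h1' i hi]

variable {b}

/-- The strong exchange condition: if `w` sends the positive root `α_i` to a negative root, then a
word for `w s_i` is obtained by deleting a letter from any word for `w`. -/
theorem exists_shorter_word {i : ι} (hi : b.IsPos i) {l : List ι} (hl : ∀ j ∈ l, j ∈ b.support)
    (h : ¬ b.IsPos (P.weylGroupToPerm (l.map (weylGroup.ofIdx P)).prod i)) :
    ∃ l' : List ι, (∀ j ∈ l', j ∈ b.support) ∧ l'.length < l.length ∧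
      (l'.map (weylGroup.ofIdx P)).prod =
        (l.map (weylGroup.ofIdx P)).prod * weylGroup.ofIdx P i := by
  induction l with
  | nil => exact absurd hi h
  | cons j l ih =>
    have hl' : ∀ k ∈ l, k ∈ b.support := fun k hk ↦ hl k (List.mem_cons_of_mem j hk)
    by_cases hp : b.IsPos (P.weylGroupToPerm (l.map (weylGroup.ofIdx P)).prod i)
    · -- The simple reflection `s_j` makes only its own root negative, so `α_j` is the image of
      -- `α_i` and `j` is the letter to delete.
      have hj : P.weylGroupToPerm (l.map (weylGroup.ofIdx P)).prod i = j := by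
        by_contra hne
        refine h ?_
        rw [List.map_cons, List.prod_cons, map_mul]
        exact hp.reflectionPerm (hl j List.mem_cons_self) hne
      refine ⟨l, hl', Nat.lt_succ_self _, ?_⟩
      rw [List.map_cons, List.prod_cons, mul_assoc, weylGroup_mul_ofIdx, hj, ← mul_assoc,
        ofIdx_mul_self, one_mul]
    · obtain ⟨l', h1, h2, h3⟩ := ih hl' hp
      refine ⟨j :: l', fun k hk ↦ ?_, Nat.succ_lt_succ h2, ?_⟩
      · rcases List.mem_cons.1 hk with rfl | hk
        exacts [hl k List.mem_cons_self, h1 k hk]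
      · rw [List.map_cons, List.prod_cons, h3, List.map_cons, List.prod_cons, mul_assoc]

theorem coxeterLength_mul_lt {w : P.weylGroup} {i : ι} (hi : b.IsPos i)
    (h : ¬ b.IsPos (P.weylGroupToPerm w i)) :
    b.coxeterLength (w * weylGroup.ofIdx P i) < b.coxeterLength w := by
  obtain ⟨l, h1, h2, rfl⟩ := b.exists_reduced_word w
  obtain ⟨l', h1', h2', h3'⟩ := exists_shorter_word hi h1 h
  rw [← h3', ← h2]
  exact (b.coxeterLength_le_length h1').trans_lt h2'

theorem coxeterLength_lt_mul {w : P.weylGroup} {i : ι} (hi : b.IsPos i)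
    (h : b.IsPos (P.weylGroupToPerm w i)) :
    b.coxeterLength w < b.coxeterLength (w * weylGroup.ofIdx P i) := by
  have h1 := coxeterLength_mul_lt (w := w * weylGroup.ofIdx P i) hi (by
    rw [weylGroup_mul_ofIdx, map_mul, Equiv.Perm.mul_apply, weylGroupToPerm_ofIdx,
      isPos_reflectionPerm_self_iff, not_not]
    exact h)
  rwa [mul_assoc, ofIdx_mul_self, mul_one] at h1

theorem bruhatStep_mul_iff {w : P.weylGroup} {i : ι} (hi : b.IsPos i) :
    b.BruhatStep w (w * weylGroup.ofIdx P i) ↔ b.IsPos (P.weylGroupToPerm w i) := by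
  refine ⟨?_, fun h ↦ ⟨i, hi, rfl, coxeterLength_lt_mul hi h⟩⟩
  rintro ⟨-, -, -, h⟩
  by_contra h'
  exact h.asymm (coxeterLength_mul_lt hi h')

theorem bruhatStep_mul_of_not_isPos {w : P.weylGroup} {i : ι} (hi : b.IsPos i)
    (h : ¬ b.IsPos (P.weylGroupToPerm w i)) : b.BruhatStep (w * weylGroup.ofIdx P i) w :=
  ⟨i, hi, by rw [mul_assoc, ofIdx_mul_self, mul_one], coxeterLength_mul_lt hi h⟩

/-- Right multiplication by a simple reflection maps a generating relation of the Bruhat order to a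
generating relation, with the exception of the relation `x < x s_j`, which it reverses. -/
theorem BruhatStep.mul_simple {x y : P.weylGroup} (h : b.BruhatStep x y) {j : ι}
    (hj : j ∈ b.support) :
    y = x * weylGroup.ofIdx P j ∨
      b.BruhatStep (x * weylGroup.ofIdx P j) (y * weylGroup.ofIdx P j) := by
  obtain ⟨i, hi, rfl, -⟩ := id h
  rw [bruhatStep_mul_iff hi] at h
  by_cases hij : i = j
  · exact Or.inl (by rw [hij])
  · right
    have h1 : x * weylGroup.ofIdx P i * weylGroup.ofIdx P j =
        x * weylGroup.ofIdx P j * weylGroup.ofIdx P (P.reflectionPerm j i) := by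
      rw [ofIdx_reflectionPerm, mul_assoc x (weylGroup.ofIdx P j),
        ← mul_assoc (weylGroup.ofIdx P j), ← mul_assoc (weylGroup.ofIdx P j), ofIdx_mul_self,
        one_mul, mul_assoc]
    rw [h1, bruhatStep_mul_iff (hi.reflectionPerm hj hij), map_mul, Equiv.Perm.mul_apply,
      weylGroupToPerm_ofIdx, P.reflectionPerm_self]
    exact h

variable (b)

theorem isLiftingOrder_bruhatOrder :
    letI := b.bruhatOrder
    IsLiftingOrder (weylGroup.ofIdx P '' b.support) b.coxeterLength := by
  let _ := b.bruhatOrder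
  have hmono : StrictMono b.coxeterLength (α := P.weylGroup) := fun x y hxy ↦
    (coxeterLength_le_of_reflTransGen b hxy.le).resolve_left hxy.ne
  have hlg : ∀ j ∈ b.support, ∀ w : P.weylGroup,
      w < w * weylGroup.ofIdx P j ∨ w * weylGroup.ofIdx P j < w := fun j hj w ↦ by
    by_cases h : b.IsPos (P.weylGroupToPerm w j)
    · exact Or.inl ((bruhatStep_mul_iff (isPos_of_mem_support hj)).2 h).lt
    · exact Or.inr (bruhatStep_mul_of_not_isPos (isPos_of_mem_support hj) h).lt
  refine ⟨?_, hmono, ?_, ?_, ?_, ?_, ?_⟩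
  · rintro _ ⟨j, hj, rfl⟩
    exact ofIdx_mul_self j
  · rintro _ ⟨j, hj, rfl⟩ w
    obtain ⟨l, h1, h2, rfl⟩ := b.exists_reduced_word w
    have := b.coxeterLength_le_length (l := l ++ [j]) fun i hi ↦ by
      rcases List.mem_append.1 hi with hi | hi
      exacts [h1 i hi, by rwa [List.mem_singleton.1 hi]]
    simpa [h2] using this
  · rintro _ ⟨j, hj, rfl⟩ w
    exact hlg j hj w
  · rintro _ ⟨j, hj, rfl⟩ x y hxy
    induction hxy with
    | refl => exact Or.inr le_rfl
    | tail _ hs ih =>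
      rcases ih with ih | ih
      · exact Or.inl (ih.trans hs.lt.le)
      · rcases hs.mul_simple hj with e | hs'
        · exact Or.inl (ih.trans e.ge)
        · exact Or.inr (ih.trans hs'.lt.le)
  · rintro _ ⟨j, hj, rfl⟩ x y hxy
    induction hxy using Relation.ReflTransGen.head_induction_on with
    | refl => exact Or.inr le_rfl
    | head hs _ ih =>
      rcases ih with ih | ih
      · exact Or.inl (hs.lt.le.trans ih)
      · rcases hs.mul_simple hj with e | hs'
        · rw [e, mul_assoc, ofIdx_mul_self, mul_one] at ih
          exact Or.inl ih
        · exact Or.inr (hs'.lt.le.trans ih)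
  · intro u v huv
    obtain ⟨l, h1, h2, rfl⟩ := b.exists_reduced_word v
    have h3 := hmono huv
    obtain rfl | ⟨l, j, rfl⟩ := l.eq_nil_or_concat'
    · exact absurd (h2 ▸ h3) (Nat.not_lt_zero _)
    · have hj : j ∈ b.support := h1 j (by simp)
      refine ⟨_, ⟨j, hj, rfl⟩, (hlg j hj _).resolve_left fun hlt ↦ ?_⟩
      have h4 := hmono hlt
      have h5 := b.coxeterLength_le_length (l := l) fun i hi ↦ h1 i (by simp [hi])
      have h6 : ((l ++ [j]).map (weylGroup.ofIdx P)).prod * weylGroup.ofIdx P j =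
          (l.map (weylGroup.ofIdx P)).prod := by
        simp [mul_assoc, ofIdx_mul_self]
      rw [h6, ← h2, List.length_append, List.length_singleton] at h4
      omega

end RootPairing.Base

/-! ### Edge labels modulo a subspace -/

namespace RootPairing.Base

variable {ι M N : Type*} [AddCommGroup M] [Module ℝ M] [AddCommGroup N] [Module ℝ N]
  {P : RootPairing ι ℝ M N}

/-- The action of `w` on `M`, followed by the projection onto `M ⧸ L`. Two elements have the same
image if and only if they differ by left multiplication by an element that acts as the identity
modulo `L`. -/
noncomputable def actionMod (L : Submodule ℝ M) (w : P.weylGroup) : M → M ⧸ L :=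
  fun m ↦ L.mkQ (w • m)

theorem actionMod_mul {L : Submodule ℝ M} {x y : P.weylGroup} (h : actionMod L x = actionMod L y)
    (g : P.weylGroup) : actionMod L (x * g) = actionMod L (y * g) := by
  funext m
  have := congrFun h (g • m)
  simpa only [actionMod, mul_smul] using this

theorem actionMod_eq_ofIdx_mul_iff {L : Submodule ℝ M} {x : P.weylGroup} {i : ι} :
    actionMod L x = actionMod L (weylGroup.ofIdx P i * x) ↔ P.root i ∈ L := by
  have key (m : M) : x • m - (weylGroup.ofIdx P i * x) • m =
      P.toLinearMap (x • m) (P.coroot i) • P.root i := by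
    rw [mul_smul, weylGroup.ofIdx_smul, Equiv.reflection_smul, P.reflection_apply, sub_sub_cancel]
    rfl
  constructor
  · intro h
    have h1 := congrFun h (x⁻¹ • P.root i)
    simp only [actionMod, Submodule.mkQ_apply] at h1
    rw [Submodule.Quotient.eq, key, smul_inv_smul, P.root_coroot_two] at h1
    exact (L.smul_mem_iff two_ne_zero).1 h1
  · intro h
    funext m
    simp only [actionMod, Submodule.mkQ_apply]
    rw [Submodule.Quotient.eq, key]
    exact L.smul_mem _ h

variable {b : P.Base} {u v w x y : P.weylGroup} {L : Submodule ℝ M}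

theorem BruhatStep.adj (h : b.BruhatStep x y) : (b.bruhatGraph).Adj x y := by
  obtain ⟨i, -, rfl, -⟩ := h
  rw [weylGroup_mul_ofIdx]
  by_cases hp : b.IsPos (P.weylGroupToPerm x i)
  · exact ⟨_, hp, rfl⟩
  · refine ⟨_, (b.isPos_reflectionPerm_self_iff _).2 hp, ?_⟩
    rw [ofIdx_reflectionPerm_self]

theorem BruhatCovBy.adj (h : b.BruhatCovBy x y) : (b.bruhatGraph).Adj x y := by
  let _ := b.bruhatOrder
  rcases Relation.ReflTransGen.cases_head h.lt.le with e | ⟨c, hxc, hcy⟩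
  · exact absurd e h.lt.ne
  · rcases (show c ≤ y from hcy).eq_or_lt with rfl | hlt
    · exact hxc.adj
    · exact absurd hlt (h.2 hxc.lt)

theorem AD_mono {u' v' : P.weylGroup} (hu : b.BruhatLE u' u) (hv : b.BruhatLE v v') :
    b.AD u v ≤ b.AD u' v' := by
  let _ := b.bruhatOrder
  refine Submodule.span_mono ?_
  rintro _ ⟨x, y, hadj, hux, hxy, hyv, rfl⟩
  exact ⟨x, y, hadj, le_trans hu hux, hxy, le_trans hyv hv, rfl⟩

theorem wt_mem_AD (huw : b.BruhatLE u w) (hwv : b.BruhatCovBy w v) : b.wt w v ∈ b.AD u v :=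
  Submodule.subset_span ⟨w, v, hwv.adj, huw, @CovBy.lt _ b.bruhatOrder.toLT _ _ hwv,
    Relation.ReflTransGen.refl, rfl⟩

theorem wt_mem_AD' (huw : b.BruhatCovBy u w) (hwv : b.BruhatLE w v) : b.wt u w ∈ b.AD u v :=
  Submodule.subset_span ⟨u, w, huw.adj, Relation.ReflTransGen.refl,
    @CovBy.lt _ b.bruhatOrder.toLT _ _ huw, hwv, rfl⟩

theorem AD_self : b.AD u u = ⊥ := by
  let _ := b.bruhatOrder
  refine (Submodule.eq_bot_iff _).2 fun a ha ↦ ?_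
  have hempty : {a | ∃ x y, (b.bruhatGraph).Adj x y ∧ b.BruhatLE u x ∧ b.BruhatLT x y ∧
      b.BruhatLE y u ∧ a = b.wt x y} = ∅ := by
    refine Set.eq_empty_of_forall_notMem ?_
    rintro _ ⟨x, y, -, hux, hxy, hyu, -⟩
    exact (le_trans hyu hux).not_gt hxy
  rwa [AD, hempty, Submodule.span_empty, Submodule.mem_bot] at ha

section

variable [P.IsReduced]

theorem actionMod_eq_iff_wt_mem (h : (b.bruhatGraph).Adj x y) :
    actionMod L x = actionMod L y ↔ b.wt x y ∈ L := by
  obtain ⟨i, hi, rfl⟩ := h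
  rw [wt_ofIdx_mul b hi, actionMod_eq_ofIdx_mul_iff]

/-- A subspace contains all labels of an interval if and only if the elements of the interval all
act in the same way modulo that subspace. -/
theorem AD_le_iff :
    b.AD u v ≤ L ↔ letI := b.bruhatOrder; ConstOnInterval (actionMod L) u v := by
  let _ := b.bruhatOrder
  constructor
  · intro h x hux hxv
    induction hux with
    | refl => rfl
    | @tail y z huy hyz ih =>
      rw [← ih (hyz.lt.le.trans hxv), eq_comm, actionMod_eq_iff_wt_mem hyz.adj]
      exact h (Submodule.subset_span ⟨y, z, hyz.adj, huy, hyz.lt, hxv, rfl⟩)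
  · intro h
    refine Submodule.span_le.2 ?_
    rintro _ ⟨x, y, hadj, hux, hxy, hyv, rfl⟩
    refine (actionMod_eq_iff_wt_mem hadj).1 ?_
    rw [h x hux (hxy.le.trans hyv), h y (le_trans hux hxy.le) hyv]

/-- Distinct neighbours of an element in the Bruhat graph have linearly independent labels. -/
theorem eq_of_wt_mem_span_wt {y' : P.weylGroup} (h : (b.bruhatGraph).Adj x y)
    (h' : (b.bruhatGraph).Adj x y') (hmem : b.wt x y' ∈ Submodule.span ℝ {b.wt x y}) :
    y' = y := by
  obtain ⟨i, hi, rfl⟩ := h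
  obtain ⟨j, hj, rfl⟩ := h'
  rw [wt_ofIdx_mul b hi, wt_ofIdx_mul b hj, Submodule.mem_span_singleton] at hmem
  obtain ⟨t, ht⟩ := hmem
  have hli : ¬ LinearIndependent ℝ ![P.root i, P.root j] := fun hli ↦ by
    have := LinearIndependent.pair_iff.1 hli t (-1) (by rw [ht, neg_one_smul, add_neg_cancel])
    exact neg_ne_zero.2 one_ne_zero this.2
  rcases IsReduced.eq_or_eq_neg i j hli with e | e
  · rw [P.root.injective e]
  · have e' : i = P.reflectionPerm j j := P.root.injective (by simpa using e)
    rw [e', ofIdx_reflectionPerm_self]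

theorem wt_comm (h : (b.bruhatGraph).Adj x y) : b.wt x y = b.wt y x := by
  obtain ⟨i, hi, rfl⟩ := h
  have h1 := wt_ofIdx_mul b hi (weylGroup.ofIdx P i * x)
  rw [← mul_assoc, ofIdx_mul_self, one_mul] at h1
  rw [h1, wt_ofIdx_mul b hi]

end

/-! ### Spans of labels of cover relations -/

variable [Finite ι] [P.IsCrystallographic] [P.IsReduced]

theorem AD_eq_sup_of_le_covBy (huw : b.BruhatLE u w) (hwv : b.BruhatCovBy w v) :
    b.AD u v = b.AD u w ⊔ Submodule.span ℝ {b.wt w v} := by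
  let _ := b.bruhatOrder
  refine le_antisymm (AD_le_iff.2 ?_) (sup_le (AD_mono le_rfl hwv.le) ?_)
  · exact b.isLiftingOrder_bruhatOrder.constOnInterval_of_le_covBy
      (f := actionMod _)
      (fun s _ _ _ h ↦ actionMod_mul h s) huw hwv
      ((actionMod_eq_iff_wt_mem hwv.adj).2
        (le_sup_right (a := b.AD u w) (Submodule.mem_span_singleton_self _)))
      (AD_le_iff.1 le_sup_left)
  · rw [Submodule.span_singleton_le_iff_mem]
    exact wt_mem_AD huw hwv

theorem AD_eq_sup_of_covBy_le (huw : b.BruhatCovBy u w) (hwv : b.BruhatLE w v) :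
    b.AD u v = b.AD w v ⊔ Submodule.span ℝ {b.wt u w} := by
  let _ := b.bruhatOrder
  refine le_antisymm (AD_le_iff.2 ?_) (sup_le (AD_mono huw.le le_rfl) ?_)
  · exact b.isLiftingOrder_bruhatOrder.constOnInterval_of_covBy_le
      (f := actionMod _)
      (fun s _ _ _ h ↦ actionMod_mul h s) huw hwv
      ((actionMod_eq_iff_wt_mem huw.adj).2
        (le_sup_right (a := b.AD w v) (Submodule.mem_span_singleton_self _)))
      (AD_le_iff.1 le_sup_left)
  · rw [Submodule.span_singleton_le_iff_mem]
    exact wt_mem_AD' huw hwv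

theorem AD_eq_span_chain {n : ℕ} (c : Fin (n + 1) → P.weylGroup)
    (hc : ∀ i : Fin n, b.BruhatCovBy (c i.castSucc) (c i.succ)) :
    b.BruhatLE (c 0) (c (Fin.last n)) ∧ b.AD (c 0) (c (Fin.last n)) =
      Submodule.span ℝ (Set.range fun i : Fin n ↦ b.wt (c i.castSucc) (c i.succ)) := by
  let _ := b.bruhatOrder
  induction n with
  | zero => exact ⟨le_rfl, by rw [Set.range_eq_empty, Submodule.span_empty]; exact AD_self⟩
  | succ n ih =>
    obtain ⟨h1, h2⟩ := ih (fun i ↦ c i.castSucc) fun i ↦ hc i.castSucc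
    have h3 : b.BruhatCovBy (c (Fin.last n).castSucc) (c (Fin.last (n + 1))) := hc (Fin.last n)
    refine ⟨le_trans h1 h3.le, ?_⟩
    rw [← Fin.castSucc_zero, AD_eq_sup_of_le_covBy h1 h3, h2, ← Submodule.span_union]
    congr 1
    ext a
    simp [Fin.exists_fin_succ', eq_comm, or_comm]

/-- The labels of `[u, w]` and of `[w, v]` together span all labels of `[u, v]`. -/
theorem AD_le_sup (huw : b.BruhatLE u w) (hwv : b.BruhatLE w v) :
    b.AD u v ≤ b.AD u w ⊔ b.AD w v := by
  let _ := b.bruhatOrder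
  have h := b.isLiftingOrder_bruhatOrder
  induction hn : b.coxeterLength v using Nat.strong_induction_on generalizing v with
  | _ n ih =>
  subst hn
  rcases (show w ≤ v from hwv).eq_or_lt with rfl | hlt
  · exact le_sup_left
  · obtain ⟨c, hwc, hcv⟩ := h.exists_le_covBy hlt
    rw [AD_eq_sup_of_le_covBy (le_trans huw hwc) hcv, AD_eq_sup_of_le_covBy hwc hcv, ← sup_assoc]
    exact sup_le_sup_right (ih _ (h.strictMono hcv.lt) hwc rfl) _

/-- The labels of an interval of length two lie in the plane spanned by the labels of any of its
saturated chains. -/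
theorem AD_le_span_pair {a c : P.weylGroup} (hua : b.BruhatCovBy u a) (hac : b.BruhatCovBy a c) :
    b.AD u c ≤ Submodule.span ℝ {b.wt u a, b.wt a c} := by
  let _ := b.bruhatOrder
  rw [AD_eq_sup_of_covBy_le hua hac.le, AD_eq_sup_of_covBy_le hac le_rfl, AD_self, bot_sup_eq,
    Submodule.span_insert, sup_comm]

/-- The labels of the atoms of a Bruhat interval span all labels of the interval. -/
theorem AD_le_span_atoms (huv : b.BruhatLE u v) :
    b.AD u v ≤ Submodule.span ℝ {a | ∃ y, b.BruhatCovBy u y ∧ b.BruhatLE y v ∧ a = b.wt u y} := by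
  let _ := b.bruhatOrder
  have h := b.isLiftingOrder_bruhatOrder
  induction hn : b.coxeterLength v - b.coxeterLength u using Nat.strong_induction_on
    generalizing u with
  | _ n ih =>
  subst hn
  rcases (show u ≤ v from huv).eq_or_lt with rfl | hlt
  · rw [AD_self]
    exact bot_le
  obtain ⟨a, hua, hav⟩ := h.exists_covBy_le hlt
  rw [AD_eq_sup_of_covBy_le hua hav]
  refine sup_le ((ih _ ?_ hav rfl).trans (Submodule.span_le.2 ?_))
    (Submodule.span_mono (Set.singleton_subset_iff.2 ⟨a, hua, hav, rfl⟩))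
  · have h1 := h.strictMono hlt
    have h2 := h.strictMono hua.lt
    omega
  rintro _ ⟨c, hac, hcv, rfl⟩
  -- The label of a second atom of `[u, c]` may be exchanged for `wt a c`.
  obtain ⟨d, hda, hud, hdc⟩ := h.exists_ne_atom hua hac
  have h1 := AD_le_span_pair hua hac (wt_mem_AD' hud hdc)
  rw [Set.pair_comm] at h1
  refine Submodule.span_mono ?_ (mem_span_insert_exchange h1
    fun hmem ↦ hda (eq_of_wt_mem_span_wt (BruhatCovBy.adj hua) (BruhatCovBy.adj hud) hmem))
  rintro _ (rfl | rfl)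
  exacts [⟨d, hud, le_trans hdc hcv, rfl⟩, ⟨a, hua, hav, rfl⟩]

/-- The labels of the coatoms of a Bruhat interval span all labels of the interval. -/
theorem AD_le_span_coatoms (huv : b.BruhatLE u v) :
    b.AD u v ≤ Submodule.span ℝ {a | ∃ x, b.BruhatLE u x ∧ b.BruhatCovBy x v ∧ a = b.wt x v} := by
  let _ := b.bruhatOrder
  have h := b.isLiftingOrder_bruhatOrder
  induction hn : b.coxeterLength v using Nat.strong_induction_on generalizing v with
  | _ n ih =>
  subst hn
  rcases (show u ≤ v from huv).eq_or_lt with rfl | hlt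
  · rw [AD_self]
    exact bot_le
  obtain ⟨a, hua, hav⟩ := h.exists_le_covBy hlt
  rw [AD_eq_sup_of_le_covBy hua hav]
  refine sup_le ((ih _ (h.strictMono hav.lt) hua rfl).trans (Submodule.span_le.2 ?_))
    (Submodule.span_mono (Set.singleton_subset_iff.2 ⟨a, hua, hav, rfl⟩))
  rintro _ ⟨c, huc, hca, rfl⟩
  -- The label of a second coatom of `[c, v]` may be exchanged for `wt c a`.
  obtain ⟨d, hda, hcd, hdv⟩ := h.exists_ne_coatom hca hav
  have h1 := AD_le_span_pair hca hav (wt_mem_AD hcd hdv)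
  refine Submodule.span_mono ?_ (mem_span_insert_exchange h1 fun hmem ↦ hda ?_)
  · rintro _ (rfl | rfl)
    exacts [⟨d, le_trans huc hcd, hdv, rfl⟩, ⟨a, hua, hav, rfl⟩]
  · rw [wt_comm (BruhatCovBy.adj hdv), wt_comm (BruhatCovBy.adj hav)] at hmem
    exact eq_of_wt_mem_span_wt (BruhatCovBy.adj hav).symm (BruhatCovBy.adj hdv).symm hmem

end RootPairing.Base

theorem mainTheorem9 {ι M N : Type*} [Finite ι] [AddCommGroup M] [Module ℝ M]
    [AddCommGroup N] [Module ℝ N] (P : RootPairing ι ℝ M N) [P.IsCrystallographic]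
    [P.IsReduced] (b : P.Base) :
    (∀ u w v : P.weylGroup, b.BruhatLE u w → b.BruhatCovBy w v →
      b.AD u v = b.AD u w ⊔ Submodule.span ℝ {b.wt w v}) ∧
    (∀ (u v : P.weylGroup) (n : ℕ) (c : Fin (n + 1) → P.weylGroup),
      c 0 = u → c (Fin.last n) = v →
      (∀ i : Fin n, b.BruhatCovBy (c i.castSucc) (c i.succ)) →
      b.AD u v = Submodule.span ℝ (Set.range fun i : Fin n => b.wt (c i.castSucc) (c i.succ))) ∧
    (∀ u w v : P.weylGroup, b.BruhatLE u w → b.BruhatLE w v →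
      b.AD u v = Submodule.span ℝ {a | ∃ x y, b.BruhatCovBy x y ∧ b.BruhatLE u x ∧
        b.BruhatLE y v ∧ (x = w ∨ y = w) ∧ a = b.wt x y}) := by
  refine ⟨fun u w v ↦ RootPairing.Base.AD_eq_sup_of_le_covBy, ?_,
    fun u w v huw hwv ↦ le_antisymm ?_ ?_⟩
  · rintro _ _ n c rfl rfl hc
    exact (RootPairing.Base.AD_eq_span_chain c hc).2
  · refine (RootPairing.Base.AD_le_sup huw hwv).trans
      (sup_le ((RootPairing.Base.AD_le_span_coatoms huw).trans ?_)
        ((RootPairing.Base.AD_le_span_atoms hwv).trans ?_))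
    · refine Submodule.span_mono ?_
      rintro _ ⟨x, hux, hxw, rfl⟩
      exact ⟨x, w, hxw, hux, hwv, Or.inr rfl, rfl⟩
    · refine Submodule.span_mono ?_
      rintro _ ⟨y, hwy, hyv, rfl⟩
      exact ⟨w, y, hwy, huw, hyv, Or.inl rfl, rfl⟩
  · refine Submodule.span_mono ?_
    rintro _ ⟨x, y, hxy, hux, hyv, -, rfl⟩
    exact ⟨x, y, RootPairing.Base.BruhatCovBy.adj hxy, hux,
      @CovBy.lt _ b.bruhatOrder.toLT _ _ hxy, hyv, rfl⟩
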